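/- Let $n \ge 0$, let $M_n$ be the space of complex $n \times n$ matrices, and for $A \in M_n$ let $\sigma(A)$ be its set of eigenvalues. For $S \subseteq M_n$ let $ES(S) = \{(A,\lambda) : A \in S,\ \lambda \in \sigma(A)\} \subseteq M_n \times \mathbb{C}$ be the eigen-surface of $S$. For $A, B \in S$, an eigenvalue $\lambda$ of $A$ is *paired* in $S$ with an eigenvalue $\mu$ of $B$ if $(A,\lambda)$ and $(B,\mu)$ lie in the same path component of $ES(S)$, that is, if there are a continuous path $A(x)$ in $S$, $x \in [0,1]$, from $A$ to $B$, and a continuous $\lambda(x) \in \sigma(A(x))$ with $\lambda(0) = \lambda$ and $\lambda(1) = \mu$. The set $S$ is *transitive* if for every $A \in S$ any two eigenvalues of $A$ that are paired in $S$ are equal. The set $S$ has *uniform multiplicity* if all matrices in $S$ have the same multiplicity list, that is, for all $A, B \in S$ and every $i \ge 1$, the number of distinct eigenvalues of algebraic multiplicity $i$ is the same for $A$ and for $B$. Let $S \subseteq M_n$ be simply connected (that is, nonempty, path-connected, and with every closed path in $S$ null-homotopic in $S$). Then $S$ is transitive if and only if $S$ has uniform multiplicity. -/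

import Mathlib

namespace EigenPairing

/-- The eigen-surface of `S ⊆ M_n(ℂ)`: all pairs `(A, lam)` with `A ∈ S` and `lam` an eigenvalue
of `A`, as a subset of the topological space `M_n(ℂ) × ℂ`. -/
def eigenSurface {n : ℕ} (S : Set (Matrix (Fin n) (Fin n) ℂ)) :
    Set (Matrix (Fin n) (Fin n) ℂ × ℂ) :=
  {p | p.1 ∈ S ∧ p.2 ∈ spectrum ℂ p.1}

/-- The eigenvalue `lam` of `A` is paired with the eigenvalue `mu` of `B` in `S`: the points
`(A, lam)` and `(B, mu)` lie in the same path component of the eigen-surface of `S`. Equivalently,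
some path in `S` from `A` to `B` carries a continuous choice of eigenvalue
that starts at `lam` and ends at `mu`. -/
def Paired {n : ℕ} (S : Set (Matrix (Fin n) (Fin n) ℂ))
    (A : Matrix (Fin n) (Fin n) ℂ) (lam : ℂ) (B : Matrix (Fin n) (Fin n) ℂ) (mu : ℂ) : Prop :=
  JoinedIn (eigenSurface S) (A, lam) (B, mu)

/-- `S` is transitive: if two eigenvalues of the same matrix of `S` are paired in `S`,
they are equal. -/
def IsTransitive {n : ℕ} (S : Set (Matrix (Fin n) (Fin n) ℂ)) : Prop :=
  ∀ A ∈ S, ∀ lam ∈ spectrum ℂ A, ∀ mu ∈ spectrum ℂ A, Paired S A lam A mu → lam = mu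

/-- The algebraic multiplicity of `lam` for `A`. -/
noncomputable def algMult {n : ℕ} (A : Matrix (Fin n) (Fin n) ℂ) (lam : ℂ) : ℕ :=
  A.charpoly.rootMultiplicity lam

/-- The multiplicity list of `A`: its entry at `i` is the number of distinct eigenvalues of `A` of
algebraic multiplicity `i` (the entry is `0` unless `1 ≤ i ≤ n`). -/
noncomputable def multiplicityList {n : ℕ} (A : Matrix (Fin n) (Fin n) ℂ) (i : ℕ) : ℕ :=
  Set.ncard {lam : ℂ | lam ∈ spectrum ℂ A ∧ algMult A lam = i}

/-- `S` has uniform multiplicity: the eigenvalues of any two matrices of `S` have the same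
algebraic multiplicities, each multiplicity being attained by equally many
distinct eigenvalues of both. -/
def HasUniformMultiplicity {n : ℕ} (S : Set (Matrix (Fin n) (Fin n) ℂ)) : Prop :=
  ∀ A ∈ S, ∀ B ∈ S, multiplicityList A = multiplicityList B

end EigenPairing

open Filter Topology Polynomial unitInterval

namespace EigenPairing

/-! Both properties amount to the number of distinct eigenvalues being constant on `S`.

If `S` is transitive, continuing eigenvalues along a path from `A` to `B`
(`exists_paired_of_joinedIn`) is injective on the spectrum: two eigenvalues reaching the same point
are paired. Reversing the path makes the counts equal. Where the count is constant, eigenvalues can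
neither split nor merge (`eventually_tuples_of_card_eq`), so the multiplicity list is locally
constant, hence constant.

Conversely, a constant count makes the eigen-surface a covering of `S` (`isCoveringMap_eigenProj`).
A loop in `S` is null-homotopic, so its lifts close up and an eigenvalue is paired with no other
eigenvalue of its matrix. -/

/-! ### Continuous selections from moving finite sets -/

/-- Small steps cannot skip a distance: a longer excursion would contain `F.card + 1` points at
distances about `4 * j * ε` from the start. By pigeonhole two of them lie near the same point of
`F`, too close to each other. -/
theorem dist_le_of_steps_near_finset {α : Type*} [PseudoMetricSpace α] {f : ℕ → α} {F : Finset α}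
    {ε : ℝ} {a b : ℕ} (hab : a ≤ b)
    (hstep : ∀ k, a ≤ k → k < b → dist (f k) (f (k + 1)) < ε)
    (hF : ∀ k, a ≤ k → k ≤ b → ∃ w ∈ F, dist (f k) w < ε) :
    dist (f a) (f b) ≤ 4 * F.card * ε := by
  classical
  have hε : 0 < ε := by
    obtain ⟨w, -, hw⟩ := hF a le_rfl hab
    exact dist_nonneg.trans_lt hw
  by_contra! h
  have key : ∀ j : ℕ, ∃ k, j ≤ F.card → a ≤ k ∧ k ≤ b ∧ 4 * j * ε ≤ dist (f a) (f k) ∧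
      dist (f a) (f k) < 4 * j * ε + ε := by
    intro j
    by_cases hj : j ≤ F.card
    swap
    · exact ⟨0, fun h ↦ absurd h hj⟩
    have hjr : (j : ℝ) ≤ F.card := by exact_mod_cast hj
    have hex : ∃ k, a ≤ k ∧ 4 * j * ε ≤ dist (f a) (f k) := by
      refine ⟨b, hab, le_trans ?_ h.le⟩
      gcongr
    have hb : Nat.find hex ≤ b := Nat.find_min' hex ⟨hab, le_trans (by gcongr) h.le⟩
    obtain ⟨h1, h2⟩ := Nat.find_spec hex
    refine ⟨Nat.find hex, fun _ ↦ ⟨h1, hb, h2, ?_⟩⟩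
    rcases h1.eq_or_lt with h3 | h3
    · rw [← h3, dist_self]
      positivity
    · obtain ⟨m, hm⟩ : ∃ m, Nat.find hex = m + 1 := ⟨Nat.find hex - 1, by omega⟩
      have h4 := Nat.find_min hex (m := m) (by omega)
      push Not at h4
      have h5 := h4 (by omega)
      have h6 := hstep m (by omega) (by omega)
      rw [hm]
      linarith [dist_triangle (f a) (f m) (f (m + 1))]
  choose k hk using key
  have hw : ∀ j, ∃ w, j ≤ F.card → w ∈ F ∧ dist (f (k j)) w < ε := by
    intro j
    by_cases hj : j ≤ F.card
    · obtain ⟨w, hw, hd⟩ := hF (k j) (hk j hj).1 (hk j hj).2.1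
      exact ⟨w, fun _ ↦ ⟨hw, hd⟩⟩
    · exact ⟨f 0, fun h ↦ absurd h hj⟩
  choose w hw using hw
  obtain ⟨i, hi, j, hj, hij, hwij⟩ := Finset.exists_ne_map_eq_of_card_lt_of_maps_to
    (s := Finset.range (F.card + 1)) (t := F) (f := w) (by simp)
    (fun j hj ↦ (hw j (by simpa [Nat.lt_succ_iff] using hj)).1)
  wlog hlt : i < j generalizing i j
  · exact this j hj i hi hij.symm hwij.symm (by omega)
  rw [Finset.mem_range, Nat.lt_succ_iff] at hi hj
  have h1 := (hk i hi).2.2.2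
  have h2 := (hk j hj).2.2.1
  have h3 := (hw i hi).2
  have h4 := (hw j hj).2
  have h5 : dist (f (k i)) (f (k j)) < 2 * ε := by
    rw [← hwij] at h4
    linarith [dist_triangle_right (f (k i)) (f (k j)) (w i)]
  have h6 : (i : ℝ) + 1 ≤ j := by exact_mod_cast hlt
  nlinarith [dist_triangle (f a) (f (k i)) (f (k j))]

/-- A uniformly continuous family of finite sets of bounded cardinality, indexed by the half-line,
has a continuous selection through any point of the initial set. -/
theorem exists_continuousOn_selection {α : Type*} [MetricSpace α] {R : ℝ → Finset α} {N : ℕ}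
    (hcard : ∀ t, (R t).card ≤ N)
    (hR : ∀ ε > 0, ∃ δ > 0, ∀ s t, |s - t| < δ → ∀ z ∈ R s, ∃ w ∈ R t, dist z w < ε)
    {z₀ : α} (hz₀ : z₀ ∈ R 0) :
    ∃ f : ℝ → α, ContinuousOn f (Set.Ici 0) ∧ f 0 = z₀ ∧ ∀ t, 0 ≤ t → f t ∈ R t := by
  have hne : ∀ t, (R t).Nonempty := by
    obtain ⟨δ, hδ, h⟩ := hR 1 one_pos
    intro t
    obtain ⟨m, hm⟩ := exists_nat_gt (|t| / δ)
    have hm0 : (0 : ℝ) < m := lt_of_le_of_lt (by positivity) hm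
    have : ∀ k : ℕ, (R (k * (t / m))).Nonempty := by
      intro k
      induction k with
      | zero => exact ⟨z₀, by simpa using hz₀⟩
      | succ k ih =>
        obtain ⟨z, hz⟩ := ih
        obtain ⟨w, hw, -⟩ := h _ ((k + 1 : ℕ) * (t / m)) (by
          push_cast
          rw [show k * (t / m) - (k + 1) * (t / m) = -(t / m) by ring, abs_neg, abs_div,
            abs_of_pos hm0, div_lt_iff₀ hm0]
          rwa [div_lt_iff₀ hδ, mul_comm] at hm) z hz
        exact ⟨w, hw⟩
    simpa [mul_div_cancel₀ _ hm0.ne'] using this m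
  have hnear : ∀ t z, ∃ w ∈ R t, ∀ w' ∈ R t, dist z w ≤ dist z w' := fun t z ↦
    Finset.exists_min_image _ _ (hne t)
  choose nr hnr hnr' using hnear
  -- Greedy chain on the mesh `1 / (m + 1)`: always move to a nearest point of the next set.
  let c : ℕ → ℕ → α := fun m k ↦ Nat.rec z₀ (fun k z ↦ nr ((k + 1 : ℕ) / (m + 1 : ℝ)) z) k
  have hc0 : ∀ m, c m 0 = z₀ := fun _ ↦ rfl
  have hcs : ∀ m k, c m (k + 1) = nr ((k + 1 : ℕ) / (m + 1 : ℝ)) (c m k) := fun _ _ ↦ rfl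
  have hcR : ∀ m k : ℕ, c m k ∈ R (k / (m + 1 : ℝ)) := by
    rintro m (_ | k)
    · simpa [hc0] using hz₀
    · rw [hcs]
      exact hnr _ _
  have hcstep : ∀ ε > 0, ∀ᶠ m in atTop, ∀ k, dist (c m k) (c m (k + 1)) < ε := by
    intro ε hε
    obtain ⟨δ, hδ, h⟩ := hR ε hε
    have hlim := (tendsto_one_div_add_atTop_nhds_zero_nat (𝕜 := ℝ)).eventually (gt_mem_nhds hδ)
    filter_upwards [hlim] with m hm k
    obtain ⟨w, hw, hd⟩ := h (k / (m + 1 : ℝ)) ((k + 1 : ℕ) / (m + 1 : ℝ)) (by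
      push_cast
      rw [← sub_div, show (k : ℝ) - (k + 1) = -1 by ring, abs_div, abs_neg, abs_one,
        abs_of_pos (by positivity)]
      exact hm) _ (hcR m k)
    rw [hcs]
    exact (hnr' _ _ w hw).trans_lt hd
  let g : ℕ → ℝ → ℕ := fun m t ↦ ⌊t * (m + 1)⌋₊
  have hg1 : ∀ m t, 0 ≤ t → (g m t : ℝ) / (m + 1) ≤ t := fun m t ht ↦ by
    rw [div_le_iff₀ (by positivity)]
    exact Nat.floor_le (by positivity)
  have hg2 : ∀ (m : ℕ) (t : ℝ), t - 1 / (m + 1 : ℝ) < (g m t : ℝ) / (m + 1) := fun m t ↦ by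
    rw [lt_div_iff₀ (by positivity), sub_mul, one_div, inv_mul_cancel₀ (by positivity)]
    linarith [Nat.lt_floor_add_one (t * (m + 1 : ℝ))]
  -- Chains for different `m` may follow different branches; an ultrafilter picks one limit for all
  -- times at once. It exists since the nearest point of `R t` takes finitely many values.
  let U : Ultrafilter ℕ := hyperfilter ℕ
  have hU : (U : Filter ℕ) ≤ atTop := by
    rw [← Nat.cofinite_eq_atTop]
    exact hyperfilter_le_cofinite
  have hlim : ∀ t, ∃ y, 0 ≤ t → y ∈ R t ∧ Tendsto (fun m ↦ c m (g m t)) U (𝓝 y) := by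
    intro t
    by_cases ht : 0 ≤ t
    swap
    · exact ⟨z₀, fun h ↦ absurd h ht⟩
    have h1 : ∀ᶠ m in U, ∃ y ∈ (R t : Set α), nr t (c m (g m t)) = y :=
      Eventually.of_forall fun m ↦ ⟨_, hnr _ _, rfl⟩
    rw [Ultrafilter.eventually_exists_mem_iff (R t).finite_toSet] at h1
    obtain ⟨y, hy, h1⟩ := h1
    refine ⟨y, fun _ ↦ ⟨hy, Metric.tendsto_nhds.2 fun ε hε ↦ ?_⟩⟩
    obtain ⟨δ, hδ, h⟩ := hR ε hε
    have hlim := (tendsto_one_div_add_atTop_nhds_zero_nat (𝕜 := ℝ)).eventually (gt_mem_nhds hδ)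
    filter_upwards [h1, hU hlim] with m hm hm2
    obtain ⟨w, hw, hd⟩ := h ((g m t : ℝ) / (m + 1)) t (by
      have h1 := hg1 m t ht
      have h2 := hg2 m t
      rw [abs_lt]
      constructor <;> linarith) _ (hcR m _)
    rw [← hm]
    exact (hnr' _ _ w hw).trans_lt hd
  choose f hf using hlim
  refine ⟨f, ?_, ?_, fun t ht ↦ (hf t ht).1⟩
  swap
  · refine tendsto_nhds_unique (hf 0 le_rfl).2 ?_
    simp [g, hc0]
  have key : ∀ ε > 0, ∃ δ > 0, ∀ s t, 0 ≤ s → s ≤ t → t - s < δ → dist (f s) (f t) ≤ 4 * N * ε := by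
    intro ε hε
    obtain ⟨δ, hδ, h⟩ := hR ε hε
    refine ⟨δ, hδ, fun s t hs hst hd ↦ ?_⟩
    have hlim := (tendsto_one_div_add_atTop_nhds_zero_nat (𝕜 := ℝ)).eventually (gt_mem_nhds hδ)
    refine le_of_tendsto ((hf s hs).2.dist (hf t (hs.trans hst)).2) ?_
    filter_upwards [hU hlim, hU (hcstep ε hε)] with m hm hm2
    have hmpos : (0 : ℝ) < m + 1 := by positivity
    -- Between times `s` and `t` the chain stays `ε`-close to the single set `R s`.
    refine (dist_le_of_steps_near_finset (F := R s) (ε := ε) ?_ (fun k _ _ ↦ hm2 k) ?_).trans ?_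
    · exact Nat.floor_le_floor (by gcongr)
    · intro k hk1 hk2
      refine h _ s ?_ _ (hcR m k)
      have h1 : (g m s : ℝ) / (m + 1) ≤ k / (m + 1) := by gcongr
      have h2 : (k : ℝ) / (m + 1) ≤ g m t / (m + 1) := by gcongr
      have h3 := hg2 m s
      have h4 := hg1 m t (hs.trans hst)
      rw [abs_lt]
      constructor <;> linarith
    · have : ((R s).card : ℝ) ≤ N := by exact_mod_cast hcard s
      gcongr
  rw [Metric.continuousOn_iff]
  intro t ht ε hε
  obtain ⟨δ, hδ, h⟩ := key (ε / (4 * N + 1)) (by positivity)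
  have hlt : 4 * N * (ε / (4 * N + 1)) < ε := by
    rw [mul_div_assoc', div_lt_iff₀ (by positivity)]
    linarith
  refine ⟨δ, hδ, fun s hs hd ↦ ?_⟩
  rw [Real.dist_eq, abs_lt] at hd
  rcases le_total s t with hst | hst
  · exact (h s t hs hst (by linarith)).trans_lt hlt
  · rw [dist_comm]
    exact (h t s ht hst (by linarith)).trans_lt hlt

/-! ### Continuity of eigenvalues with multiplicity -/

variable {n : ℕ}

/-- `v` lists the eigenvalues of `A` with algebraic multiplicity. -/
def IsEigenvalueTuple (A : Matrix (Fin n) (Fin n) ℂ) (v : Fin n → ℂ) : Prop :=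
  A.charpoly = ∏ i, (X - C (v i))

theorem exists_isEigenvalueTuple (A : Matrix (Fin n) (Fin n) ℂ) :
    ∃ v, IsEigenvalueTuple A v := by
  have hs := IsAlgClosed.splits A.charpoly
  have hcard : A.charpoly.roots.toList.length = n := by
    rw [Multiset.length_toList, ← hs.natDegree_eq_card_roots, Matrix.charpoly_natDegree_eq_dim,
      Fintype.card_fin]
  refine ⟨fun i ↦ A.charpoly.roots.toList.get (i.cast hcard.symm), ?_⟩
  unfold IsEigenvalueTuple
  conv_lhs => rw [hs.eq_prod_roots_of_monic A.charpoly_monic,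
    ← Multiset.coe_toList A.charpoly.roots]
  rw [Multiset.map_coe, Multiset.prod_coe, ← List.prod_ofFn]
  congr 1
  apply List.ext_get <;> simp [hcard]

namespace IsEigenvalueTuple

variable {A : Matrix (Fin n) (Fin n) ℂ} {v : Fin n → ℂ}

theorem roots_eq (h : IsEigenvalueTuple A v) : A.charpoly.roots = Finset.univ.val.map v := by
  rw [show A.charpoly = ((Finset.univ.val.map v).map fun a ↦ X - C a).prod by
    rw [Multiset.map_map]
    exact h, roots_multiset_prod_X_sub_C]

theorem mem_spectrum_iff (h : IsEigenvalueTuple A v) {z : ℂ} :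
    z ∈ spectrum ℂ A ↔ ∃ i, v i = z := by
  rw [Matrix.mem_spectrum_iff_isRoot_charpoly, ← mem_roots A.charpoly_monic.ne_zero, h.roots_eq]
  simp

theorem algMult_eq (h : IsEigenvalueTuple A v) (z : ℂ) :
    algMult A z = (Finset.univ.filter fun i ↦ v i = z).card := by
  rw [algMult, ← count_roots, h.roots_eq, Multiset.count_map, Finset.card_def, Finset.filter_val]
  simp only [eq_comm]

end IsEigenvalueTuple

/-- Crude form of Gershgorin's theorem; the bound is continuous in `A`, which confines the
eigenvalues of nearby matrices to a compact set. -/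
theorem norm_le_of_mem_spectrum {A : Matrix (Fin n) (Fin n) ℂ} {z : ℂ} (hz : z ∈ spectrum ℂ A) :
    ‖z‖ ≤ ∑ i, ∑ j, ‖A i j‖ := by
  rw [← Matrix.spectrum_toLin', ← Module.End.hasEigenvalue_iff_mem_spectrum] at hz
  obtain ⟨k, hk⟩ := eigenvalue_mem_ball hz
  rw [mem_closedBall_iff_norm] at hk
  calc ‖z‖ ≤ ‖A k k‖ + ‖z - A k k‖ := norm_le_norm_add_norm_sub' z (A k k)
    _ ≤ ‖A k k‖ + ∑ j ∈ Finset.univ.erase k, ‖A k j‖ := by gcongr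
    _ = ∑ j, ‖A k j‖ := Finset.add_sum_erase _ (fun j ↦ ‖A k j‖) (Finset.mem_univ k)
    _ ≤ ∑ i, ∑ j, ‖A i j‖ :=
      Finset.single_le_sum (f := fun i ↦ ∑ j, ‖A i j‖) (fun i _ ↦ by positivity)
        (Finset.mem_univ k)

/-- Suitable enumerations of the eigenvalues of `A` and `B` differ by less than `ε`. -/
def EigenvaluesWithin (ε : ℝ) (A B : Matrix (Fin n) (Fin n) ℂ) : Prop :=
  ∃ v w, IsEigenvalueTuple A v ∧ IsEigenvalueTuple B w ∧ ∀ i, dist (v i) (w i) < ε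

theorem EigenvaluesWithin.symm {ε : ℝ} {A B : Matrix (Fin n) (Fin n) ℂ}
    (h : EigenvaluesWithin ε A B) : EigenvaluesWithin ε B A := by
  obtain ⟨v, w, hv, hw, hd⟩ := h
  exact ⟨w, v, hw, hv, fun i ↦ by rw [dist_comm]; exact hd i⟩

theorem EigenvaluesWithin.exists_dist_lt {ε : ℝ} {A B : Matrix (Fin n) (Fin n) ℂ}
    (h : EigenvaluesWithin ε A B) {z : ℂ} (hz : z ∈ spectrum ℂ A) :
    ∃ w ∈ spectrum ℂ B, dist z w < ε := by
  obtain ⟨v, w, hv, hw, hd⟩ := h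
  obtain ⟨i, rfl⟩ := hv.mem_spectrum_iff.1 hz
  exact ⟨w i, hw.mem_spectrum_iff.2 ⟨i, rfl⟩, hd i⟩

/-- The eigenvalues of a matrix, with multiplicity, depend continuously on the matrix. -/
theorem eventually_eigenvaluesWithin (B : Matrix (Fin n) (Fin n) ℂ) {ε : ℝ} (hε : 0 < ε) :
    ∀ᶠ A in 𝓝 B, EigenvaluesWithin ε A B := by
  by_contra hcon
  rw [not_eventually] at hcon
  have : NeBot (𝓝 B ⊓ 𝓟 {A | ¬ EigenvaluesWithin ε A B}) := frequently_mem_iff_neBot.1 hcon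
  obtain ⟨U, hU⟩ := Ultrafilter.exists_le (𝓝 B ⊓ 𝓟 {A | ¬ EigenvaluesWithin ε A B})
  have hUB : (U : Filter (Matrix (Fin n) (Fin n) ℂ)) ≤ 𝓝 B := hU.trans inf_le_left
  have hUn : ∀ᶠ A in (U : Filter (Matrix (Fin n) (Fin n) ℂ)), ¬ EigenvaluesWithin ε A B :=
    le_principal_iff.1 (hU.trans inf_le_right)
  choose v hv using exists_isEigenvalueTuple (n := n)
  have hbound : ∀ᶠ A in (U : Filter (Matrix (Fin n) (Fin n) ℂ)),
      v A ∈ Metric.closedBall (0 : Fin n → ℂ) (∑ i, ∑ j, ‖B i j‖ + 1) := by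
    have hc : Continuous fun A : Matrix (Fin n) (Fin n) ℂ ↦ ∑ i, ∑ j, ‖A i j‖ := by fun_prop
    filter_upwards [hUB (hc.continuousAt.eventually (gt_mem_nhds (lt_add_one _)))] with A hA
    rw [mem_closedBall_zero_iff, pi_norm_le_iff_of_nonneg (by positivity)]
    exact fun i ↦ (norm_le_of_mem_spectrum ((hv A).mem_spectrum_iff.2 ⟨i, rfl⟩)).trans
      (le_of_lt hA)
  obtain ⟨w, -, hw⟩ := (isCompact_closedBall (0 : Fin n → ℂ)
    (∑ i, ∑ j, ‖B i j‖ + 1)).ultrafilter_le_nhds (U.map v) (le_principal_iff.2 hbound)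
  have hw : Tendsto v U (𝓝 w) := hw
  -- The limit tuple lists the roots of the limit polynomial: compare values at each `z`.
  have hwB : IsEigenvalueTuple B w := by
    refine funext fun z ↦ ?_
    have h1 : Tendsto (fun A : Matrix (Fin n) (Fin n) ℂ ↦ A.charpoly.eval z) U
        (𝓝 (B.charpoly.eval z)) := by
      have hc : Continuous fun A : Matrix (Fin n) (Fin n) ℂ ↦ A.charpoly.eval z := by
        simp only [Matrix.eval_charpoly]
        fun_prop
      exact hc.continuousAt.mono_left hUB
    have h2 : Tendsto (fun A : Matrix (Fin n) (Fin n) ℂ ↦ A.charpoly.eval z) U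
        (𝓝 ((∏ i, (X - C (w i))).eval z)) := by
      have hc : Continuous fun u : Fin n → ℂ ↦ (∏ i, (X - C (u i))).eval z := by
        simp only [eval_prod, eval_sub, eval_X, eval_C]
        fun_prop
      refine (hc.continuousAt.tendsto.comp hw).congr fun A ↦ ?_
      rw [hv A, Function.comp_apply]
    exact tendsto_nhds_unique h1 h2
  obtain ⟨A, hA, hAn⟩ := ((hw.eventually (Metric.ball_mem_nhds w hε)).and hUn).exists
  refine hAn ⟨v A, w, hv A, hwB, fun i ↦ ?_⟩
  exact (dist_le_pi_dist _ _ i).trans_lt hA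

/-- The set of eigenvalues of `A`. -/
noncomputable def eigenvalueFinset (A : Matrix (Fin n) (Fin n) ℂ) : Finset ℂ :=
  A.charpoly.roots.toFinset

theorem mem_eigenvalueFinset {A : Matrix (Fin n) (Fin n) ℂ} {z : ℂ} :
    z ∈ eigenvalueFinset A ↔ z ∈ spectrum ℂ A := by
  rw [eigenvalueFinset, Multiset.mem_toFinset, mem_roots A.charpoly_monic.ne_zero,
    Matrix.mem_spectrum_iff_isRoot_charpoly]

theorem IsEigenvalueTuple.eigenvalueFinset_eq {A : Matrix (Fin n) (Fin n) ℂ} {v : Fin n → ℂ}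
    (h : IsEigenvalueTuple A v) : eigenvalueFinset A = Finset.univ.image v := by
  ext z
  simp [mem_eigenvalueFinset, h.mem_spectrum_iff]

theorem card_eigenvalueFinset_le (A : Matrix (Fin n) (Fin n) ℂ) :
    (eigenvalueFinset A).card ≤ n := by
  obtain ⟨v, hv⟩ := exists_isEigenvalueTuple A
  rw [hv.eigenvalueFinset_eq]
  exact Finset.card_image_le.trans (by simp)

theorem exists_separation (F : Finset ℂ) :
    ∃ ε > 0, ∀ z ∈ F, ∀ w ∈ F, dist z w < ε → z = w := by
  have h : ∀ᶠ ε in 𝓝[>] (0 : ℝ), ∀ z ∈ F, ∀ w ∈ F, dist z w < ε → z = w := by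
    simp only [eventually_all_finset]
    intro z _ w _
    by_cases hzw : z = w
    · exact Eventually.of_forall fun _ _ ↦ hzw
    · filter_upwards [Ioo_mem_nhdsGT (dist_pos.2 hzw)] with ε hε hd
      exact absurd hd hε.2.not_gt
  obtain ⟨ε, hε, hpos⟩ := (h.and self_mem_nhdsWithin).exists
  exact ⟨ε, hpos, hε⟩

/-- With equal coincidence patterns, `v i ↦ w i` is a well-defined multiplicity-preserving bijection
of spectra. -/
theorem multiplicityList_eq_of_tuples {A B : Matrix (Fin n) (Fin n) ℂ} {v w : Fin n → ℂ}
    (hv : IsEigenvalueTuple A v) (hw : IsEigenvalueTuple B w)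
    (h : ∀ i j, v i = v j ↔ w i = w j) : multiplicityList A = multiplicityList B := by
  ext m
  have hfac : Function.FactorsThrough w v := fun i j hij ↦ (h i j).1 hij
  have hg : ∀ i, Function.extend v w 0 (v i) = w i := fun i ↦ hfac.extend_apply 0 i
  have hinj : Set.InjOn (Function.extend v w 0)
      {z | z ∈ spectrum ℂ A ∧ algMult A z = m} := by
    rintro _ ⟨hx, -⟩ _ ⟨hy, -⟩ hxy
    obtain ⟨i, rfl⟩ := hv.mem_spectrum_iff.1 hx
    obtain ⟨j, rfl⟩ := hv.mem_spectrum_iff.1 hy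
    rw [hg, hg] at hxy
    exact (h i j).2 hxy
  have hmult : ∀ i, algMult A (v i) = algMult B (w i) := fun i ↦ by
    simp only [hv.algMult_eq, hw.algMult_eq, h]
  rw [multiplicityList, multiplicityList, ← hinj.ncard_image]
  congr 1
  ext z
  constructor
  · rintro ⟨_, ⟨hx, hm⟩, rfl⟩
    obtain ⟨i, rfl⟩ := hv.mem_spectrum_iff.1 hx
    rw [hg]
    exact ⟨hw.mem_spectrum_iff.2 ⟨i, rfl⟩, (hmult i).symm.trans hm⟩
  · rintro ⟨hx, hm⟩
    obtain ⟨i, rfl⟩ := hw.mem_spectrum_iff.1 hx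
    exact ⟨v i, ⟨hv.mem_spectrum_iff.2 ⟨i, rfl⟩, (hmult i).trans hm⟩, hg i⟩

/-- Near `B`, the eigenvalues of a matrix with as many distinct eigenvalues as `B` coincide
exactly as those of `B` do. -/
theorem eventually_tuples_of_card_eq (B : Matrix (Fin n) (Fin n) ℂ) {ε : ℝ} (hε : 0 < ε) :
    ∀ᶠ A in 𝓝 B, (eigenvalueFinset A).card = (eigenvalueFinset B).card →
      ∃ v w, IsEigenvalueTuple A v ∧ IsEigenvalueTuple B w ∧ (∀ i, dist (v i) (w i) < ε) ∧
        ∀ i j, v i = v j ↔ w i = w j := by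
  obtain ⟨η, hη, hsep⟩ := exists_separation (eigenvalueFinset B)
  filter_upwards [eventually_eigenvaluesWithin B (lt_min hε (half_pos hη))] with A hA hcard
  obtain ⟨v, w, hv, hw, hd⟩ := hA
  have hvw : ∀ i j, v i = v j → w i = w j := fun i j hij ↦ by
    refine hsep _ (mem_eigenvalueFinset.2 (hw.mem_spectrum_iff.2 ⟨i, rfl⟩)) _
      (mem_eigenvalueFinset.2 (hw.mem_spectrum_iff.2 ⟨j, rfl⟩)) ?_
    have h1 := (hd i).trans_le (min_le_right _ _)
    have h2 := (hd j).trans_le (min_le_right _ _)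
    rw [← hij] at h2
    linarith [dist_triangle_left (w i) (w j) (v i)]
  refine ⟨v, w, hv, hw, fun i ↦ (hd i).trans_le (min_le_left _ _), fun i j ↦ ⟨hvw i j, ?_⟩⟩
  have hg : ∀ i, Function.extend v w 0 (v i) = w i :=
    fun i ↦ Function.FactorsThrough.extend_apply (fun i j ↦ hvw i j) 0 i
  -- The map `v i ↦ w i` is onto; between sets of equal size it is then injective.
  have himg : (eigenvalueFinset A).image (Function.extend v w 0) = eigenvalueFinset B := by
    rw [hv.eigenvalueFinset_eq, hw.eigenvalueFinset_eq, Finset.image_image]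
    exact Finset.image_congr fun i _ ↦ hg i
  have hinj : Set.InjOn (Function.extend v w 0) (eigenvalueFinset A) := by
    rw [← Finset.card_image_iff, himg, hcard]
  intro hij
  refine hinj (mem_eigenvalueFinset.2 (hv.mem_spectrum_iff.2 ⟨i, rfl⟩))
    (mem_eigenvalueFinset.2 (hv.mem_spectrum_iff.2 ⟨j, rfl⟩)) ?_
  rw [hg, hg, hij]

theorem HasUniformMultiplicity.card_eigenvalueFinset_eq {S : Set (Matrix (Fin n) (Fin n) ℂ)}
    (h : HasUniformMultiplicity S) {A B : Matrix (Fin n) (Fin n) ℂ} (hA : A ∈ S) (hB : B ∈ S) :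
    (eigenvalueFinset A).card = (eigenvalueFinset B).card := by
  have key : ∀ A : Matrix (Fin n) (Fin n) ℂ,
      (eigenvalueFinset A).card = ∑ m ∈ Finset.range (n + 1), multiplicityList A m := by
    intro A
    rw [Finset.card_eq_sum_card_fiberwise (f := algMult A) (t := Finset.range (n + 1))]
    · refine Finset.sum_congr rfl fun m _ ↦ ?_
      rw [multiplicityList, ← Set.ncard_coe_finset]
      congr 1
      ext z
      simp [mem_eigenvalueFinset]
    · intro z _
      obtain ⟨v, hv⟩ := exists_isEigenvalueTuple A
      have : algMult A z ≤ n := by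
        rw [hv.algMult_eq]
        exact (Finset.card_le_univ _).trans (by simp)
      simpa [Nat.lt_succ_iff] using this
  rw [key, key, h A hA B hB]

/-! ### Transitivity implies uniform multiplicity -/

variable {S : Set (Matrix (Fin n) (Fin n) ℂ)}

/-- Along a path in `S`, every eigenvalue of the initial matrix can be continued continuously. -/
theorem exists_paired_of_joinedIn {A B : Matrix (Fin n) (Fin n) ℂ} (h : JoinedIn S A B) {z : ℂ}
    (hz : z ∈ spectrum ℂ A) : ∃ w ∈ spectrum ℂ B, Paired S A z B w := by
  obtain ⟨γ, hγ⟩ := h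
  have hunif : ∀ ε > 0, ∃ δ > 0, ∀ s t, |s - t| < δ → ∀ z ∈ eigenvalueFinset (γ.extend s),
      ∃ w ∈ eigenvalueFinset (γ.extend t), dist z w < ε := by
    intro ε hε
    -- A Lebesgue number makes the continuity uniform: close times `s`, `t` are compared with a
    -- common `γ x`.
    have hc : ∀ x : I, x ∈ (Set.univ : Set I) → {t | EigenvaluesWithin (ε / 2) (γ t) (γ x)} ∈ 𝓝 x :=
      fun x _ ↦ γ.continuous.continuousAt.eventually
        (eventually_eigenvaluesWithin (γ x) (half_pos hε))
    obtain ⟨δ, hδ, hsub⟩ := Metric.uniformity_basis_dist.lebesgue_number_lemma_nhds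
      isCompact_univ hc
    refine ⟨δ, hδ, fun s t hst z hz ↦ ?_⟩
    obtain ⟨x, hx⟩ := hsub (Set.projIcc 0 1 zero_le_one s) (Set.mem_univ _)
    have hs : EigenvaluesWithin (ε / 2) (γ.extend s) (γ x) := hx (by
      change dist _ _ < δ
      rwa [dist_self])
    have ht : EigenvaluesWithin (ε / 2) (γ.extend t) (γ x) := hx (by
      change dist _ _ < δ
      exact (LipschitzWith.projIcc zero_le_one).dist_le_mul s t |>.trans_lt (by
        simpa [Real.dist_eq] using hst))
    obtain ⟨u, hu, hzu⟩ := hs.exists_dist_lt (mem_eigenvalueFinset.1 hz)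
    obtain ⟨w, hw, huw⟩ := ht.symm.exists_dist_lt hu
    exact ⟨w, mem_eigenvalueFinset.2 hw, by linarith [dist_triangle z u w]⟩
  obtain ⟨f, hf, hf0, hfR⟩ := exists_continuousOn_selection (fun _ ↦ card_eigenvalueFinset_le _)
    hunif (z₀ := z) (by simpa [mem_eigenvalueFinset] using hz)
  have hmem : ∀ t : I, f t ∈ spectrum ℂ (γ t) := fun t ↦ by
    simpa [mem_eigenvalueFinset] using hfR t t.2.1
  refine ⟨f 1, by simpa using hmem 1, ⟨⟨fun t ↦ (γ t, f t), ?_⟩, ?_, ?_⟩, fun t ↦ ⟨hγ t, hmem t⟩⟩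
  · exact γ.continuous.prodMk (hf.comp_continuous continuous_subtype_val fun t ↦ t.2.1)
  · simp [hf0]
  · simp

theorem IsTransitive.card_eigenvalueFinset_le (hS : IsTransitive S)
    {A B : Matrix (Fin n) (Fin n) ℂ} (h : JoinedIn S A B) :
    (eigenvalueFinset A).card ≤ (eigenvalueFinset B).card := by
  have hex : ∀ z, ∃ w, z ∈ spectrum ℂ A → w ∈ spectrum ℂ B ∧ Paired S A z B w := by
    intro z
    by_cases hz : z ∈ spectrum ℂ A
    · obtain ⟨w, hw⟩ := exists_paired_of_joinedIn h hz
      exact ⟨w, fun _ ↦ hw⟩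
    · exact ⟨0, fun h ↦ absurd h hz⟩
  choose φ hφ using hex
  refine Finset.card_le_card_of_injOn φ
    (fun z hz ↦ mem_eigenvalueFinset.2 (hφ z (mem_eigenvalueFinset.1 hz)).1) ?_
  intro z hz w hw hzw
  have hz := mem_eigenvalueFinset.1 hz
  have hw := mem_eigenvalueFinset.1 hw
  refine hS A h.source_mem z hz w hw ((hφ z hz).2.trans ?_)
  rw [hzw]
  exact (hφ w hw).2.symm

theorem IsTransitive.hasUniformMultiplicity (hS : IsTransitive S) (hpc : IsPathConnected S) :
    HasUniformMultiplicity S := by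
  have hcard : ∀ A ∈ S, ∀ B ∈ S, (eigenvalueFinset A).card = (eigenvalueFinset B).card :=
    fun A hA B hB ↦ le_antisymm (hS.card_eigenvalueFinset_le (hpc.joinedIn A hA B hB))
      (hS.card_eigenvalueFinset_le (hpc.joinedIn B hB A hA))
  have hloc : IsLocallyConstant fun A : S ↦ multiplicityList A.1 := by
    rw [IsLocallyConstant.iff_eventually_eq]
    intro B
    filter_upwards [continuous_subtype_val.continuousAt.eventually
      (eventually_tuples_of_card_eq B.1 one_pos)] with A hA
    obtain ⟨v, w, hv, hw, -, h⟩ := hA (hcard _ A.2 _ B.2)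
    exact multiplicityList_eq_of_tuples hv hw h
  have := isPathConnected_iff_pathConnectedSpace.1 hpc
  exact fun A hA B hB ↦ hloc.apply_eq_of_preconnectedSpace ⟨A, hA⟩ ⟨B, hB⟩

/-! ### The eigen-surface as a covering space -/

/-- The projection of the eigen-surface of `S` onto `S`. -/
def eigenProj (S : Set (Matrix (Fin n) (Fin n) ℂ)) (p : eigenSurface S) : S :=
  ⟨p.1.1, p.2.1⟩

theorem continuous_eigenProj : Continuous (eigenProj S) :=
  (continuous_fst.comp continuous_subtype_val).subtype_mk _

theorem isOpenMap_eigenProj : IsOpenMap (eigenProj S) := by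
  rw [isOpenMap_iff_nhds_le]
  rintro ⟨⟨B, z⟩, hB, hz⟩ O hO
  rw [mem_map] at hO
  obtain ⟨O', hO', hsub⟩ := mem_nhds_subtype _ _ _ |>.1 hO
  obtain ⟨U, hU, V, hV, hUV⟩ := mem_nhds_prod_iff.1 hO'
  obtain ⟨ε, hε, hball⟩ := Metric.mem_nhds_iff.1 hV
  have hev : ∀ᶠ A in 𝓝 B, EigenvaluesWithin ε A B ∧ A ∈ U :=
    (eventually_eigenvaluesWithin B hε).and hU
  filter_upwards [(continuous_subtype_val.continuousAt (x := (⟨B, hB⟩ : S))).eventually hev] with A hA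
  obtain ⟨w, hw, hd⟩ := hA.1.symm.exists_dist_lt hz
  exact hsub (a := ⟨(A.1, w), A.2, hw⟩) (hUV ⟨hA.2, hball (by rwa [Metric.mem_ball'])⟩)

/-- Near `B`, each disc of radius `η / 2` about an eigenvalue of `B` contains exactly one distinct
eigenvalue of `A`. These discs cut out the sheets. -/
theorem isCoveringMap_eigenProj
    (hcard : ∀ A ∈ S, ∀ B ∈ S, (eigenvalueFinset A).card = (eigenvalueFinset B).card) :
    IsCoveringMap (eigenProj S) := by
  -- The surface is empty when `n = 0`.
  cases isEmpty_or_nonempty (eigenSurface S)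
  · exact IsCoveringMap.of_isEmpty _
  obtain ⟨⟨A₁, z₁⟩, hA₁, hz₁⟩ := ‹Nonempty (eigenSurface S)›
  intro B
  have hne : Nonempty (eigenvalueFinset B.1) := by
    rw [Finset.nonempty_coe_sort, ← Finset.card_pos, hcard B B.2 A₁ hA₁, Finset.card_pos]
    exact ⟨z₁, mem_eigenvalueFinset.2 hz₁⟩
  have hne' : Nonempty (S → eigenSurface S) := ⟨fun _ ↦ ⟨⟨A₁, z₁⟩, hA₁, hz₁⟩⟩
  obtain ⟨η, hη, hsep⟩ := exists_separation (eigenvalueFinset B.1)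
  have hev := (continuous_subtype_val.continuousAt (x := B)).eventually
    (eventually_tuples_of_card_eq B.1 (half_pos hη))
  obtain ⟨V, hV, hVo, hBV⟩ := eventually_nhds_iff.1 hev
  have hV' := fun A hA ↦ hV A hA (hcard _ A.2 _ B.2)
  let U : eigenvalueFinset B.1 → Set (eigenSurface S) :=
    fun l ↦ {p | dist p.1.2 l < η / 2} ∩ eigenProj S ⁻¹' V
  have hUo : ∀ l, IsOpen (U l) := fun l ↦
    (isOpen_lt (by fun_prop) continuous_const).inter (hVo.preimage continuous_eigenProj)
  have hl : ∀ l : eigenvalueFinset B.1, (l : ℂ) ∈ spectrum ℂ B.1 :=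
    fun l ↦ mem_eigenvalueFinset.1 l.2
  have hsurj : ∀ l, Set.SurjOn (eigenProj S) (U l) V := by
    intro l A hA
    obtain ⟨v, w, hv, hw, hd, -⟩ := hV' A hA
    obtain ⟨i, hi⟩ := hw.mem_spectrum_iff.1 (hl l)
    refine ⟨⟨(A.1, v i), A.2, hv.mem_spectrum_iff.2 ⟨i, rfl⟩⟩, ⟨?_, hA⟩, rfl⟩
    change dist (v i) l < η / 2
    rw [← hi]
    exact hd i
  have hinj : ∀ l, Set.InjOn (eigenProj S) (U l) := by
    rintro l ⟨⟨A, x⟩, hA, hx⟩ ⟨hxl, hAV⟩ ⟨⟨A', y⟩, hA', hy⟩ ⟨hyl, -⟩ heq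
    obtain rfl : A = A' := congrArg Subtype.val heq
    obtain ⟨v, w, hv, hw, hd, hvw⟩ := hV' ⟨A, hA⟩ hAV
    obtain ⟨i, rfl⟩ := hv.mem_spectrum_iff.1 hx
    obtain ⟨j, rfl⟩ := hv.mem_spectrum_iff.1 hy
    have hwl : ∀ k, dist (v k) l < η / 2 → w k = l := fun k hk ↦
      hsep _ (mem_eigenvalueFinset.2 (hw.mem_spectrum_iff.2 ⟨k, rfl⟩)) _ l.2
        (by linarith [dist_triangle_left (w k) (l : ℂ) (v k), hd k])
    have hij : v i = v j := (hvw i j).2 ((hwl i hxl).trans (hwl j hyl).symm)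
    exact Subtype.ext (Prod.ext rfl hij)
  have hdisj : Pairwise (Function.onFun Disjoint U) := by
    intro l l' hll'
    refine Set.disjoint_left.2 fun p hp hp' ↦ hll' (Subtype.ext (hsep _ l.2 _ l'.2 ?_))
    have h1 : dist p.1.2 l < η / 2 := hp.1
    have h2 : dist p.1.2 l' < η / 2 := hp'.1
    linarith [dist_triangle_left (l : ℂ) l' p.1.2]
  have hexh : eigenProj S ⁻¹' V ⊆ ⋃ l, U l := by
    rintro ⟨⟨A, x⟩, hA, hx⟩ hAV
    obtain ⟨v, w, hv, hw, hd, -⟩ := hV' ⟨A, hA⟩ hAV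
    obtain ⟨i, rfl⟩ := hv.mem_spectrum_iff.1 hx
    exact Set.mem_iUnion.2
      ⟨⟨w i, mem_eigenvalueFinset.2 (hw.mem_spectrum_iff.2 ⟨i, rfl⟩)⟩, hd i, hAV⟩
  refine (IsEvenlyCovered.of_trivialization (t := hVo.trivializationDiscrete U V
    (fun l W hWV ↦ ⟨fun hW ↦ (hW.preimage continuous_eigenProj).inter (hUo l), fun hW ↦ ?_⟩)
    hinj hsurj hdisj hexh) hBV).to_isEvenlyCovered_preimage
  convert isOpenMap_eigenProj _ hW using 1
  ext A
  constructor
  · intro hA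
    obtain ⟨p, hp, rfl⟩ := hsurj l (hWV hA)
    exact ⟨p, ⟨hA, hp⟩, rfl⟩
  · rintro ⟨p, ⟨hp, -⟩, rfl⟩
    exact hp

/-- A pairing path lifts a loop in `S`. The loop is homotopic to a constant one, so by homotopy
lifting its lift ends where the constant lift does. -/
theorem HasUniformMultiplicity.isTransitive (hS : HasUniformMultiplicity S)
    (hsc : IsSimplyConnected S) : IsTransitive S := by
  have cov := isCoveringMap_eigenProj fun A hA B hB ↦ hS.card_eigenvalueFinset_eq hA hB
  have := hsc.simplyConnectedSpace
  rintro A hA z hz w hw ⟨γ, hγ⟩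
  let e : eigenSurface S := ⟨(A, z), hA, hz⟩
  let Γ : C(I, eigenSurface S) := ⟨fun t ↦ ⟨γ t, hγ t⟩, γ.continuous.subtype_mk _⟩
  let g : Path (⟨A, hA⟩ : S) ⟨A, hA⟩ :=
    { toFun := fun t ↦ eigenProj S (Γ t)
      continuous_toFun := continuous_eigenProj.comp Γ.continuous
      source' := by simp [Γ, eigenProj]
      target' := by simp [Γ, eigenProj] }
  have hΓ : Γ = cov.liftPath g.toContinuousMap e g.source :=
    (cov.eq_liftPath_iff' g.source).2 ⟨rfl, Subtype.ext γ.source⟩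
  have hconst : ContinuousMap.const I e = cov.liftPath (Path.refl (⟨A, hA⟩ : S)).toContinuousMap
      e rfl :=
    (cov.eq_liftPath_iff' _).2 ⟨rfl, rfl⟩
  have h := cov.liftPath_apply_one_eq_of_homotopicRel
    (SimplyConnectedSpace.paths_homotopic g (Path.refl _)) e g.source rfl
  rw [← hΓ, ← hconst] at h
  have h1 : γ 1 = (A, z) := congrArg Subtype.val h
  rw [γ.target] at h1
  exact (congrArg Prod.snd h1).symm

end EigenPairing

theorem mainTheorem2 (n : ℕ) (S : Set (Matrix (Fin n) (Fin n) ℂ)) (hS : IsSimplyConnected S) :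
    EigenPairing.IsTransitive S ↔ EigenPairing.HasUniformMultiplicity S :=
  ⟨fun h ↦ h.hasUniformMultiplicity hS.isPathConnected, fun h ↦ h.isTransitive hS⟩
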